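/- Let $[n]=\{1,\dots,n\}$ and put $P_0(a,b,c)=1$ and $P_n(a,b,c)=c\prod_{i=1}^{n-1}\bigl(ia+(n-i)b+c\bigr)$ for $n\ge 1$. All trees are rooted. For $m\ge 2$, an \emph{$m$-ary tree on $[n]$} is a tree with linearly ordered children in which every vertex has either $m$ or $0$ children and in which the vertices with $m$ children (and only these) are labeled bijectively by $[n]$; the vertices without children are called leaves. A \emph{$k$-colored ordered forest on $[n]$} is a linearly ordered sequence of trees, with vertices labeled bijectively by $[n]$, in which the children of each vertex are linearly ordered and each edge has one of the colors $1,\dots,k$, such that among the children of any vertex those joined to it by edges of color $1$ come first, then those of color $2$, and so on (not every color need appear). In both cases $\mathrm{prop}$ denotes the number of \emph{proper} vertices, that is, labeled vertices whose label is less than the labels of all their labeled proper descendants; other labeled vertices are \emph{improper}. For an $m$-ary tree $T$ on $[n]$, the \emph{decomposing path} starts at the root and stops when it reaches a leaf; from a labeled vertex $x$ it goes to the first child of $x$, unless $x$ is improper and the smallest descendant of $x$ is also a descendant of the first child of $x$, in which case it goes to the second child of $x$. Let $\mathrm{comp}\,T$ be the number of labeled vertices on this path. For a $k$-colored ordered forest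 $F$, let $\mathrm{comp}\,F$ be the number of left-right minima (entries smaller than all earlier entries) in the sequence of the roots of its trees. Then for all integers $k\ge 1$ and $n\ge 0$, as polynomials in $u,v,w$, \[ \sum_{T} v^{\,n-\mathrm{prop}\,T}\,u^{\,\mathrm{prop}\,T-\mathrm{comp}\,T}\,w^{\,\mathrm{comp}\,T} =\sum_{F} u^{\,n-\mathrm{prop}\,F}\,v^{\,\mathrm{prop}\,F-\mathrm{comp}\,F}\,w^{\,\mathrm{comp}\,F} =P_n\bigl(ku,(k+1)v,w\bigr), \] where $T$ runs over the $(k+1)$-ary trees on $[n]$ and $F$ runs over the $k$-colored ordered forests on $[n]$. -/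

import Mathlib

/-- The polynomials `P_n(a,b,c) = c ∏_{i=1}^{n-1} (i a + (n-i) b + c)` for `n ≥ 1`, with `P_0 = 1`
(the constant term of the exponential generating function of the `P_n`). -/
def cayleyPoly {R : Type*} [CommRing R] (n : ℕ) (a b c : R) : R :=
  if n = 0 then 1
  else c * ∏ i ∈ Finset.Ico 1 n, ((i : R) * a + ((n : R) - (i : R)) * b + c)

/-! ### `m`-ary trees -/

/-- `m`-ary trees in which every vertex is either a leaf (an unlabeled vertex of degree `0`) or a
vertex of degree `m`, carrying a natural number as label, whose children are linearly ordered
(child `0` is the first child, child `1` the second child, and so on). -/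
inductive MAryTree (m : ℕ) : Type
  | leaf : MAryTree m
  | node (label : ℕ) (children : Fin m → MAryTree m) : MAryTree m

namespace MAryTree

variable {m : ℕ}

/-- The multiset of all labels of a tree. -/
def labels : MAryTree m → Multiset ℕ
  | leaf => 0
  | node a c => a ::ₘ ∑ i, (c i).labels

/-- The multiset of the labels of all descendants of the vertices with subtrees `c i`; these are the
labels of the proper descendants of `node a c`. -/
def labelsBelow (c : Fin m → MAryTree m) : Multiset ℕ := ∑ i, (c i).labels

/-- The root of `node a c` is proper: its label is less than the labels of all its proper
descendants. -/
def RootProper (a : ℕ) (c : Fin m → MAryTree m) : Prop := ∀ x ∈ labelsBelow c, a < x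

instance (a : ℕ) (c : Fin m → MAryTree m) : Decidable (RootProper a c) :=
  inferInstanceAs (Decidable (∀ x ∈ labelsBelow c, a < x))

/-- The number of proper vertices among the labeled vertices. -/
def prop : MAryTree m → ℕ
  | leaf => 0
  | node a c => (if RootProper a c then 1 else 0) + ∑ i, (c i).prop

/-- The root of `node a c` is improper and its smallest descendant is also a descendant of its first
child. -/
def TurnsAtRoot (hm : 1 < m) (a : ℕ) (c : Fin m → MAryTree m) : Prop :=
  ¬ RootProper a c ∧
    ∃ x ∈ (c ⟨0, Nat.zero_lt_of_lt hm⟩).labels, ∀ y ∈ (node a c).labels, x ≤ y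

instance (hm : 1 < m) (a : ℕ) (c : Fin m → MAryTree m) : Decidable (TurnsAtRoot hm a c) :=
  @instDecidableAnd _ _ _
    (Multiset.decidableExistsMultiset (p := fun x => ∀ y ∈ (node a c).labels, x ≤ y))

/-- The labels of the successive labeled vertices on the decomposing path, for `m ≥ 2`. From a
labeled vertex the path goes to the first child, unless the vertex is improper and its smallest
descendant is also a descendant of its first child: then it goes to the second child. The path
stops at a leaf. -/
def decomposingPath (hm : 1 < m) : MAryTree m → List ℕ
  | leaf => []
  | node a c =>
      a :: (if TurnsAtRoot hm a c then decomposingPath hm (c ⟨1, hm⟩)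
            else decomposingPath hm (c ⟨0, Nat.zero_lt_of_lt hm⟩))

/-- The number of components: the number of labeled vertices on the decomposing path. -/
def comp (hm : 1 < m) (T : MAryTree m) : ℕ := (T.decomposingPath hm).length

theorem mem_sum_labels {c : Fin m → MAryTree m} {x : ℕ} :
    x ∈ labelsBelow c ↔ ∃ i, x ∈ (c i).labels := by
  simp [labelsBelow, Multiset.mem_sum]

theorem finite_labels (S : Finset ℕ) (N : ℕ) :
    {T : MAryTree m | T.labels.card ≤ N ∧ ∀ x ∈ T.labels, x ∈ S}.Finite := by
  induction N with
  | zero =>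
    refine (Set.finite_singleton (leaf : MAryTree m)).subset ?_
    rintro (_ | ⟨a, c⟩) ⟨h, -⟩
    · rfl
    · simp [labels] at h
  | succ N ih =>
    refine ((Set.finite_singleton (leaf : MAryTree m)).union
      (Set.Finite.image2 (fun a c => node a c) S.finite_toSet
        (Set.Finite.pi (fun _ : Fin m => ih)))).subset ?_
    rintro (_ | ⟨a, c⟩) ⟨h, h'⟩
    · exact Or.inl rfl
    · refine Or.inr ⟨a, h' a (by simp [labels]), c, ?_, rfl⟩
      intro i _
      have hi : (c i).labels ≤ ∑ j, (c j).labels :=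
        Finset.single_le_sum (f := fun j => (c j).labels) (fun _ _ => Multiset.zero_le _)
          (Finset.mem_univ i)
      refine ⟨(Multiset.card_le_card hi).trans ?_, fun x hx => h' x ?_⟩
      · simpa [labels] using h
      · exact Multiset.mem_cons_of_mem (Multiset.mem_of_le hi hx)

theorem prop_le_card_labels (T : MAryTree m) : T.prop ≤ T.labels.card := by
  induction T with
  | leaf => simp [prop]
  | node a c ih =>
    have := Finset.sum_le_sum (fun i (_ : i ∈ Finset.univ) => ih i)
    simp only [prop, labels, Multiset.card_cons, Multiset.card_sum]
    split_ifs <;> lia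

theorem prop_pos {T : MAryTree m} {x : ℕ} (h : x ∈ T.labels) : 0 < T.prop := by
  induction T generalizing x with
  | leaf => simp [labels] at h
  | node a c ih =>
    by_cases hp : RootProper a c
    · simp only [prop, if_pos hp]; lia
    · simp only [RootProper] at hp
      push Not at hp
      obtain ⟨y, hy, -⟩ := hp
      obtain ⟨i, hi⟩ := mem_sum_labels.1 hy
      have h1 := ih i hi
      have h2 := Finset.single_le_sum (f := fun j => (c j).prop) (fun _ _ => Nat.zero_le _)
        (Finset.mem_univ i)
      simp only [prop]
      lia

/-- Hence the exponent `prop T - comp T` is a genuine natural number. -/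
theorem comp_le_prop (hm : 1 < m) (T : MAryTree m) : T.comp hm ≤ T.prop := by
  induction T with
  | leaf => simp [comp, decomposingPath]
  | node a c ih =>
    have key : ∀ i j : Fin m, i ≠ j → (c i).prop + (c j).prop ≤ ∑ l, (c l).prop := by
      intro i j hij
      rw [← Finset.sum_pair hij (f := fun l => (c l).prop)]
      exact Finset.sum_le_sum_of_subset (Finset.subset_univ _)
    have single : ∀ i : Fin m, (c i).prop ≤ ∑ l, (c l).prop := fun i =>
      Finset.single_le_sum (f := fun j => (c j).prop) (fun _ _ => Nat.zero_le _)
        (Finset.mem_univ i)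
    have h0 := ih ⟨0, by lia⟩
    have h1 := ih ⟨1, hm⟩
    simp only [comp] at h0 h1
    simp only [comp, decomposingPath, List.length_cons, prop]
    by_cases hp : RootProper a c
    · rw [if_neg (fun h => h.1 hp), if_pos hp]
      have := single ⟨0, by lia⟩
      lia
    · rw [if_neg hp]
      split_ifs with hs
      · obtain ⟨-, x, hx, -⟩ := hs
        have hpos := prop_pos hx
        have := key ⟨0, by lia⟩ ⟨1, hm⟩ (by simp)
        lia
      · have hex : ∃ i, i ≠ (⟨0, by lia⟩ : Fin m) ∧ ∃ x, x ∈ (c i).labels := by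
          by_contra hcon
          push Not at hcon
          apply hs
          refine ⟨hp, ?_⟩
          have hp' := hp
          simp only [RootProper] at hp'
          push Not at hp'
          obtain ⟨z, hz, hza⟩ := hp'
          have hall : ∀ y ∈ labelsBelow c, y ∈ (c ⟨0, by lia⟩).labels := by
            intro y hy
            obtain ⟨i, hi⟩ := mem_sum_labels.1 hy
            by_cases h : i = ⟨0, by lia⟩
            · rwa [h] at hi
            · exact absurd hi (hcon i h y)
          obtain ⟨x, hx, hmin⟩ := Finset.exists_min_image (c ⟨0, by lia⟩).labels.toFinset id
            ⟨z, Multiset.mem_toFinset.2 (hall z hz)⟩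
          simp only [Multiset.mem_toFinset, id] at hx hmin
          refine ⟨x, hx, fun y hy => ?_⟩
          rcases Multiset.mem_cons.1 hy with rfl | hy
          · exact (hmin z (hall z hz)).trans hza
          · exact hmin y (hall y hy)
        obtain ⟨i, hi, x, hx⟩ := hex
        have hpos := prop_pos hx
        have := key i ⟨0, by lia⟩ hi
        lia

/-- The `m`-ary trees on the label set `S`: every element of `S` is the label of exactly one
labeled vertex, and there are no other labels. -/
def On (m : ℕ) (S : Finset ℕ) : Type := {T : MAryTree m // T.labels = S.val}

instance (S : Finset ℕ) : Finite (On m S) :=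
  ((finite_labels S S.card).subset (fun T (hT : T.labels = S.val) => by
    simp [hT])).to_subtype

noncomputable instance (S : Finset ℕ) : Fintype (On m S) := Fintype.ofFinite _

end MAryTree

/-! ### `k`-colored ordered forests -/

/-- `k`-colored ordered trees: every vertex carries a natural number as label, its children are
linearly ordered, the edges to the children are colored with `k` colors, and the children of the
first color come first, then those of the second color, and so on. Thus the children of a vertex are
given by the ordered list `children i` of those of color `i`, for every color `i`, the full ordered
list of children being the concatenation of these `k` (possibly empty) lists. -/
inductive ColoredTree (k : ℕ) : Type
  | node (label : ℕ) (children : Fin k → List (ColoredTree k)) : ColoredTree k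

/-- A `k`-colored ordered forest is a linearly ordered sequence of `k`-colored ordered trees. -/
abbrev ColoredForest (k : ℕ) : Type := List (ColoredTree k)

/-- The number of left-right minima of a sequence: the number of entries that are less than all
earlier entries. -/
def leftRightMinima (l : List ℕ) : ℕ :=
  (Finset.univ.filter (fun i : Fin l.length => ∀ j : Fin l.length, j < i → l[i] < l[j])).card

/-- The label of the root of a tree. -/
def ColoredTree.root {k : ℕ} : ColoredTree k → ℕ
  | .node a _ => a

mutual

/-- The multiset of all labels of a tree. -/
def ColoredTree.labels {k : ℕ} : ColoredTree k → Multiset ℕ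
  | .node a c => a ::ₘ ∑ i, ColoredForest.labels (c i)

/-- The multiset of all labels of a forest. -/
def ColoredForest.labels {k : ℕ} : List (ColoredTree k) → Multiset ℕ
  | [] => 0
  | T :: F => T.labels + ColoredForest.labels F

end

/-- The multiset of the labels of the proper descendants of `node a c`. -/
def ColoredTree.labelsBelow {k : ℕ} (c : Fin k → List (ColoredTree k)) : Multiset ℕ :=
  ∑ i, ColoredForest.labels (c i)

mutual

/-- The number of proper vertices of a tree: vertices whose label is less than the labels of all
their proper descendants. -/
def ColoredTree.prop {k : ℕ} : ColoredTree k → ℕ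
  | .node a c => (if ∀ x ∈ ColoredTree.labelsBelow c, a < x then 1 else 0) +
      ∑ i, ColoredForest.prop (c i)

/-- The number of proper vertices of a forest. -/
def ColoredForest.prop {k : ℕ} : List (ColoredTree k) → ℕ
  | [] => 0
  | T :: F => T.prop + ColoredForest.prop F

end

namespace ColoredForest

variable {k : ℕ}

/-- The number of components of a forest: the number of left-right minima in the sequence of its
roots. -/
def comp (F : ColoredForest k) : ℕ := leftRightMinima (F.map ColoredTree.root)

theorem finite_labels (S : Finset ℕ) (N : ℕ) :
    {F : ColoredForest k | (labels F).card ≤ N ∧ ∀ x ∈ labels F, x ∈ S}.Finite := by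
  induction N with
  | zero =>
    refine (Set.finite_singleton ([] : ColoredForest k)).subset ?_
    rintro (_ | ⟨⟨a, c⟩, F⟩) ⟨h, -⟩
    · rfl
    · simp [labels, ColoredTree.labels] at h
  | succ N ih =>
    refine ((Set.finite_singleton ([] : ColoredForest k)).union
      (Set.Finite.image2 (fun T F => T :: F)
        (Set.Finite.image2 (fun a c => ColoredTree.node a c) S.finite_toSet
          (Set.Finite.pi (fun _ : Fin k => ih))) ih)).subset ?_
    rintro (_ | ⟨⟨a, c⟩, F⟩) ⟨h, h'⟩
    · exact Or.inl rfl
    · simp only [labels, ColoredTree.labels, Multiset.cons_add, Multiset.card_cons,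
        Multiset.card_add] at h
      simp only [labels, ColoredTree.labels, Multiset.cons_add, Multiset.mem_cons,
        Multiset.mem_add] at h'
      refine Or.inr ⟨_, ⟨a, h' a (Or.inl rfl), c, ?_, rfl⟩, F, ⟨by lia, fun x hx => ?_⟩, rfl⟩
      · intro i _
        have hi : labels (c i) ≤ ∑ j, labels (c j) :=
          Finset.single_le_sum (f := fun j => labels (c j)) (fun _ _ => Multiset.zero_le _)
            (Finset.mem_univ i)
        refine ⟨(Multiset.card_le_card hi).trans (by lia), fun x hx => h' x ?_⟩
        exact Or.inr (Or.inl (Multiset.mem_of_le hi hx))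
      · exact h' x (Or.inr (Or.inr hx))

mutual

theorem tree_prop_le : ∀ T : ColoredTree k, T.prop ≤ T.labels.card
  | .node a c => by
    have := Finset.sum_le_sum (fun i (_ : i ∈ Finset.univ) => prop_le_card_labels (c i))
    simp only [ColoredTree.prop, ColoredTree.labels, Multiset.card_cons, Multiset.card_sum]
    split_ifs <;> lia

theorem prop_le_card_labels : ∀ F : List (ColoredTree k), prop F ≤ (labels F).card
  | [] => by simp [prop]
  | T :: F => by
    have := tree_prop_le T
    have := prop_le_card_labels F
    simp only [prop, labels, Multiset.card_add]
    lia

end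

mutual

theorem tree_prop_pos : ∀ T : ColoredTree k, 0 < T.prop
  | .node a c => by
    by_cases hp : ∀ x ∈ ColoredTree.labelsBelow c, a < x
    · simp only [ColoredTree.prop, if_pos hp]; lia
    · push Not at hp
      obtain ⟨y, hy, -⟩ := hp
      simp only [ColoredTree.labelsBelow, Multiset.mem_sum, Finset.mem_univ, true_and] at hy
      obtain ⟨i, hi⟩ := hy
      have h1 := length_le_prop (c i)
      have h3 : 0 < (c i).length := List.length_pos_iff.2 (by rintro h; simp [h, labels] at hi)
      have h2 := Finset.single_le_sum (f := fun j => prop (c j)) (fun _ _ => Nat.zero_le _)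
        (Finset.mem_univ i)
      simp only [ColoredTree.prop]
      lia

theorem length_le_prop : ∀ F : List (ColoredTree k), F.length ≤ prop F
  | [] => by simp
  | T :: F => by
    have := tree_prop_pos T
    have := length_le_prop F
    simp only [prop, List.length_cons]
    lia

end

/-- Hence the exponent `prop F - comp F` is a genuine natural number. -/
theorem comp_le_prop (F : ColoredForest k) : comp F ≤ prop F := by
  refine le_trans ?_ (length_le_prop F)
  unfold comp leftRightMinima
  refine (Finset.card_filter_le _ _).trans ?_
  simp

/-- The `k`-colored ordered forests on the label set `S`: every element of `S` is the label of
exactly one vertex, and there are no other labels. -/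
def On (k : ℕ) (S : Finset ℕ) : Type := {F : ColoredForest k // labels F = S.val}

instance (S : Finset ℕ) : Finite (On k S) :=
  ((finite_labels S S.card).subset (fun F (hF : labels F = S.val) => by
    simp [hF])).to_subtype

noncomputable instance (S : Finset ℕ) : Fintype (On k S) := Fintype.ofFinite _

end ColoredForest

-- Write `A_c` for the exponential generating function of `P_n(a,b,c)` and `D_c` for `A_c' / c`,
-- defined by its coefficients so that it also makes sense at `c = 0`. Two facts drive everything.
-- Splitting one factor off the product gives `D_c = A_{c+a} + b x D_{c+a}`
-- (`cayleyDerivSeries_eq`). The convolution law `A_c A_d = A_{c+d}` (`cayleySeries_mul`), with `D_c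
-- A_d = D_{c+d}`, turns products of series into sums of parameters.
--
-- Each proper vertex is marked by `u` for trees (`v` for forests), each improper one by the other
-- variable, and each component by an extra `t`. Let `φ` be the resulting series at `t = 1` and `ψ`
-- the series for general `t`.
--
-- Trees with `m = κ + 2`: a root carrying the smallest label is proper and the path enters the
-- first child. Otherwise the smallest label lies in some child `i`, and the path enters the first
-- child other than `i`, so no matter what `i` is, the path child is independent of the child
-- holding the minimum. Hence `ψ' = t u ψ φ^(κ+1) + t v (κ+2) x φ' ψ φ^κ`. With `φ = A_u`, `ψ =
-- A_{tu}`, `a = (κ+1)u`, `b = (κ+2)v` this is the recurrence for `D_{tu}`.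
--
-- Forests: the law of left-right minima over all orderings of given trees does not depend on the
-- distinct keys compared, so roots may be replaced by smallest labels. Then the tree `T` containing
-- the overall minimum is the last left-right minimum, and `ψ' = t τ' ψ φ` for the tree series `τ`.
-- As a tree is a root with `k` forests, `τ' = v φ^k + u x (φ^k)'`; this is again the recurrence,
-- now with `a = (k+1)v`, `b = ku`, `c = tv`. Symmetry in `a, b` matches the two answers, and `t =
-- w/u` or `t = w/v` recovers the stated weights.

open PowerSeries

-- Generating series of the polynomials and their convolution law

section CayleySeries

variable {K : Type*} [Field K]

/-- The exponential generating function of the polynomials `cayleyPoly n a b c`. -/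
noncomputable def cayleySeries (a b c : K) : PowerSeries K :=
  PowerSeries.mk fun n => cayleyPoly n a b c / (n.factorial : K)

/-- The derivative of `cayleySeries a b c` divided by `c`. -/
noncomputable def cayleyDerivSeries (a b c : K) : PowerSeries K :=
  PowerSeries.mk fun n =>
    (∏ i ∈ Finset.range n, (((i : K) + 1) * a + ((n : K) - i) * b + c)) / (n.factorial : K)

theorem cayleyPoly_succ {R : Type*} [CommRing R] (n : ℕ) (a b c : R) :
    cayleyPoly (n + 1) a b c =
      c * ∏ i ∈ Finset.range n, (((i : R) + 1) * a + ((n : R) - i) * b + c) := by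
  rw [cayleyPoly, if_neg (Nat.succ_ne_zero n), Finset.prod_Ico_eq_prod_range]
  congr 1
  refine Finset.prod_congr (by simp) fun i _ => ?_
  push_cast
  ring

theorem constantCoeff_cayleySeries (a b c : K) : constantCoeff (cayleySeries a b c) = 1 := by
  rw [← coeff_zero_eq_constantCoeff_apply]
  simp [cayleySeries, cayleyPoly]

/-- Reversing the product by `i ↦ n - 1 - i` exchanges `a` and `b`. -/
theorem cayleyDerivSeries_comm (a b c : K) :
    cayleyDerivSeries a b c = cayleyDerivSeries b a c := by
  ext n
  rw [cayleyDerivSeries, cayleyDerivSeries, coeff_mk, coeff_mk, ← Finset.prod_range_reflect]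
  congr 1
  refine Finset.prod_congr rfl fun i hi => ?_
  have hi := Finset.mem_range.1 hi
  rw [Nat.sub_sub, Nat.cast_sub (by lia)]
  push_cast
  ring

theorem cayleySeries_comm (a b c : K) : cayleySeries a b c = cayleySeries b a c := by
  ext n
  rcases n with _ | n
  · simp [cayleySeries, cayleyPoly]
  · have h := congrArg (coeff n) (cayleyDerivSeries_comm a b c)
    rw [cayleyDerivSeries, cayleyDerivSeries, coeff_mk, coeff_mk] at h
    rw [cayleySeries, cayleySeries, coeff_mk, coeff_mk, cayleyPoly_succ, cayleyPoly_succ,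
      Nat.factorial_succ]
    push_cast
    rw [mul_comm ((n : K) + 1), ← div_div, ← div_div, mul_div_assoc, h, mul_div_assoc,
      mul_div_assoc, mul_div_assoc]

theorem eq_of_forall_X_pow_dvd_sub {f g : PowerSeries K} (h : ∀ n, X ^ n ∣ f - g) : f = g := by
  ext n
  have := X_pow_dvd_iff.1 (h (n + 1)) n n.lt_succ_self
  rwa [map_sub, sub_eq_zero] at this

variable [CharZero K]

theorem factorial_mul_coeff_cayleySeries (a b c : K) (n : ℕ) :
    (n.factorial : K) * coeff n (cayleySeries a b c) = cayleyPoly n a b c := by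
  have : (n.factorial : K) ≠ 0 := Nat.cast_ne_zero.2 n.factorial_ne_zero
  rw [cayleySeries, coeff_mk]
  field_simp

theorem derivative_cayleySeries (a b c : K) :
    derivative K (cayleySeries a b c) = C c * cayleyDerivSeries a b c := by
  ext n
  have h : (n.factorial : K) ≠ 0 := Nat.cast_ne_zero.2 n.factorial_ne_zero
  have h' : (n : K) + 1 ≠ 0 := Nat.cast_add_one_ne_zero n
  rw [coeff_derivative, coeff_C_mul, cayleySeries, cayleyDerivSeries, coeff_mk, coeff_mk,
    cayleyPoly_succ, Nat.factorial_succ]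
  generalize ∏ i ∈ Finset.range n, (((i : K) + 1) * a + ((n : K) - i) * b + c) = p
  push_cast
  field_simp

/-- In degree `n + 1` the factor `i = 0` is `(c + a) + (n + 1) b`, and the remaining factors are
those of degree `n` with `c` replaced by `c + a`. The two summands of that factor give the two
terms. -/
theorem cayleyDerivSeries_eq (a b c : K) :
    cayleyDerivSeries a b c =
      cayleySeries a b (c + a) + C b * (X * cayleyDerivSeries a b (c + a)) := by
  ext n
  rcases n with _ | n
  · simp [cayleySeries, cayleyPoly, cayleyDerivSeries]
  · have h : (n.factorial : K) ≠ 0 := Nat.cast_ne_zero.2 n.factorial_ne_zero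
    have h' : (n : K) + 1 ≠ 0 := Nat.cast_add_one_ne_zero n
    rw [map_add, coeff_C_mul, coeff_succ_X_mul, cayleySeries, cayleyDerivSeries,
      cayleyDerivSeries, coeff_mk, coeff_mk, coeff_mk, cayleyPoly_succ, Nat.factorial_succ,
      Finset.prod_range_succ']
    have e : ∏ i ∈ Finset.range n,
        (((↑(i + 1) : K) + 1) * a + ((↑(n + 1) : K) - ↑(i + 1)) * b + c) =
        ∏ i ∈ Finset.range n, (((i : K) + 1) * a + ((n : K) - i) * b + (c + a)) :=
      Finset.prod_congr rfl fun i _ => by push_cast; ring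
    rw [e]
    generalize ∏ i ∈ Finset.range n, (((i : K) + 1) * a + ((n : K) - i) * b + (c + a)) = p
    push_cast
    field_simp
    ring

theorem X_pow_succ_dvd_of_derivative {n : ℕ} {f : PowerSeries K} (h0 : constantCoeff f = 0)
    (h : X ^ n ∣ derivative K f) : X ^ (n + 1) ∣ f := by
  rw [X_pow_dvd_iff] at h ⊢
  rintro (_ | m) hm
  · simpa using h0
  · have := h m (by lia)
    rw [coeff_derivative] at this
    exact (mul_eq_zero.1 this).resolve_right (Nat.cast_add_one_ne_zero m)

/-- A power series with zero constant term and a homogeneous linear differential equation of the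
first order modulo `X ^ n` vanishes modulo `X ^ (n + 1)`. -/
theorem X_pow_succ_dvd_of_linear_ode {n : ℕ} {f g : PowerSeries K} (h0 : constantCoeff f = 0)
    (h : X ^ n ∣ derivative K f - g * f) : X ^ (n + 1) ∣ f := by
  induction n with
  | zero => simpa [X_dvd_iff] using h0
  | succ n ih =>
    have hf := ih ((pow_dvd_pow _ n.le_succ).trans h)
    refine X_pow_succ_dvd_of_derivative h0 ?_
    simpa using dvd_add h (hf.mul_left g)

/-- The convolution law and `D_c = D_0 A_c` are bootstrapped together, one power of `X` at a time.
The parameter `c` must vary, since the step uses the parameters `a`, `c + a` and those of a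
convolution. -/
theorem X_pow_dvd_cayleyDerivSeries_sub (a b : K) (n : ℕ) (c : K) :
    X ^ n ∣ cayleyDerivSeries a b c - cayleyDerivSeries a b 0 * cayleySeries a b c := by
  induction n generalizing c with
  | zero => simp
  | succ n ih =>
    -- By the induction hypothesis both `A_c A_d` and `A_{c+d}` satisfy `f' = (c + d) D_0 f` modulo
    -- `X ^ n`; integration gains one power.
    have hmul (d : K) : X ^ (n + 1) ∣
        cayleySeries a b c * cayleySeries a b d - cayleySeries a b (c + d) := by
      refine X_pow_succ_dvd_of_linear_ode (g := C (c + d) * cayleyDerivSeries a b 0)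
        (by simp [constantCoeff_cayleySeries]) ?_
      rw [map_sub, Derivation.leibniz, derivative_cayleySeries, derivative_cayleySeries,
        derivative_cayleySeries, smul_eq_mul, smul_eq_mul]
      have := dvd_sub (dvd_add ((ih c).mul_left (C c * cayleySeries a b d))
        ((ih d).mul_left (C d * cayleySeries a b c))) ((ih (c + d)).mul_left (C (c + d)))
      convert this using 1
      rw [map_add]
      ring
    have h1 := hmul a
    have h2 := mul_dvd_mul (dvd_refl (X : PowerSeries K)) (ih (c + a))
    have h3 := mul_dvd_mul (dvd_refl (X : PowerSeries K)) (ih a)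
    rw [← pow_succ'] at h2 h3
    rw [cayleyDerivSeries_eq a b c]
    have h4 := cayleyDerivSeries_eq a b 0
    rw [zero_add] at h4
    have := dvd_sub (dvd_sub (h2.mul_left (C b)) (h3.mul_left (C b * cayleySeries a b c)))
      (h1.mul_left (1 + C b * X * cayleyDerivSeries a b 0))
    convert this using 1
    -- What remains is `D_0 = A_a + b X D_a` multiplied by `A_c`; the factor `X` in the recurrence
    -- supplied the gained power in `h2` and `h3`.
    linear_combination (-cayleySeries a b c) * h4

theorem cayleyDerivSeries_eq_mul (a b c : K) :
    cayleyDerivSeries a b c = cayleyDerivSeries a b 0 * cayleySeries a b c :=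
  eq_of_forall_X_pow_dvd_sub fun n => X_pow_dvd_cayleyDerivSeries_sub a b n c

/-- The convolution identity for the polynomials `cayleyPoly`. -/
theorem cayleySeries_mul (a b c d : K) :
    cayleySeries a b c * cayleySeries a b d = cayleySeries a b (c + d) := by
  refine eq_of_forall_X_pow_dvd_sub fun n => ?_
  refine (pow_dvd_pow _ n.le_succ).trans (X_pow_succ_dvd_of_linear_ode
    (g := C (c + d) * cayleyDerivSeries a b 0)
    (by simp [constantCoeff_cayleySeries]) ?_)
  rw [map_sub, Derivation.leibniz, derivative_cayleySeries, derivative_cayleySeries,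
    derivative_cayleySeries, smul_eq_mul, smul_eq_mul, cayleyDerivSeries_eq_mul a b c,
    cayleyDerivSeries_eq_mul a b d, cayleyDerivSeries_eq_mul a b (c + d), map_add]
  convert dvd_zero (X ^ n : PowerSeries K) using 1
  ring

theorem cayleySeries_pow (a b c : K) (n : ℕ) :
    cayleySeries a b c ^ n = cayleySeries a b (n * c) := by
  induction n with
  | zero =>
    ext m
    rcases m with _ | m <;> simp [cayleySeries, cayleyPoly, coeff_one]
  | succ n ih =>
    rw [pow_succ, ih, cayleySeries_mul]
    push_cast
    ring_nf

theorem cayleyDerivSeries_mul (a b c d : K) :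
    cayleyDerivSeries a b c * cayleySeries a b d = cayleyDerivSeries a b (c + d) := by
  rw [cayleyDerivSeries_eq_mul a b c, cayleyDerivSeries_eq_mul a b (c + d), ← cayleySeries_mul,
    mul_assoc]

theorem cayleyPoly_succ_eq_coeff (a b c : K) (n : ℕ) :
    cayleyPoly (n + 1) a b c = c * (n.factorial * coeff n (cayleyDerivSeries a b c)) := by
  have : (n.factorial : K) ≠ 0 := Nat.cast_ne_zero.2 n.factorial_ne_zero
  rw [cayleyPoly_succ, cayleyDerivSeries, coeff_mk, mul_div_cancel₀ _ this]

end CayleySeries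

-- Labeled structures and exponential generating functions

/-- A class of structures labelled by natural numbers, with finitely many structures on every
finite set of labels. -/
class LabeledClass (α : Type*) where
  /-- The multiset of labels of a structure. -/
  labels : α → Multiset ℕ
  finite_labels_eq : ∀ S : Finset ℕ, {x | labels x = S.val}.Finite

namespace LabeledClass

variable {α β K : Type*} [LabeledClass α] [LabeledClass β]

/-- The structures with label set `S`. -/
noncomputable def onSet (α : Type*) [LabeledClass α] (S : Finset ℕ) : Finset α :=
  (finite_labels_eq S).toFinset

@[simp]
theorem mem_onSet {S : Finset ℕ} {x : α} : x ∈ onSet α S ↔ labels x = S.val := by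
  simp [onSet]

/-- Because `S.val` has no repetitions, a splitting of it as a multiset is just a choice of subset.
-/
theorem add_eq_val_iff {s t : Multiset ℕ} {S : Finset ℕ} :
    s + t = S.val ↔ ∃ A ⊆ S, s = A.val ∧ t = (S \ A).val := by
  constructor
  · intro h
    have hs : s ≤ S.val := h ▸ Multiset.le_add_right s t
    let A : Finset ℕ := ⟨s, Multiset.nodup_of_le hs S.nodup⟩
    refine ⟨A, Finset.val_le_iff.1 hs, rfl, ?_⟩
    rw [Finset.sdiff_val]
    exact (tsub_eq_of_eq_add_rev h.symm).symm
  · rintro ⟨A, hA, rfl, rfl⟩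
    rw [Finset.sdiff_val, add_tsub_cancel_of_le (Finset.val_le_iff.2 hA)]

instance : LabeledClass (α × β) where
  labels p := labels p.1 + labels p.2
  finite_labels_eq S := by
    refine (S.powerset.finite_toSet.biUnion fun A _ =>
      (finite_labels_eq (α := α) A).prod (finite_labels_eq (α := β) (S \ A))).subset ?_
    rintro ⟨x, y⟩ h
    obtain ⟨A, hA, hx, hy⟩ := add_eq_val_iff.1 h
    exact Set.mem_biUnion (Finset.mem_coe.2 (Finset.mem_powerset.2 hA)) ⟨hx, hy⟩

theorem labels_prod (p : α × β) : labels p = labels p.1 + labels p.2 := rfl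

theorem sum_onSet_prod [AddCommMonoid K] (S : Finset ℕ) (f : α → β → K) :
    ∑ p ∈ onSet (α × β) S, f p.1 p.2 =
      ∑ A ∈ S.powerset, ∑ x ∈ onSet α A, ∑ y ∈ onSet β (S \ A), f x y := by
  classical
  rw [← Finset.sum_fiberwise_of_maps_to (g := fun p : α × β => (labels p.1).toFinset)
    (t := S.powerset)]
  · refine Finset.sum_congr rfl fun A hA => ?_
    rw [← Finset.sum_product']
    refine Finset.sum_congr ?_ fun _ _ => rfl
    ext p
    simp only [Finset.mem_filter, mem_onSet, Finset.mem_product, labels_prod]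
    constructor
    · rintro ⟨h, rfl⟩
      obtain ⟨A, -, hx, hy⟩ := add_eq_val_iff.1 h
      rw [hx, Finset.val_toFinset]
      exact ⟨rfl, hy⟩
    · rintro ⟨hx, hy⟩
      refine ⟨add_eq_val_iff.2 ⟨A, Finset.mem_powerset.1 hA, hx, hy⟩, ?_⟩
      rw [hx, Finset.val_toFinset]
  · intro p hp
    obtain ⟨A, hA, hx, -⟩ := add_eq_val_iff.1 (mem_onSet.1 hp)
    rw [hx, Finset.val_toFinset]
    exact Finset.mem_powerset.2 hA

theorem sum_onSet_equiv [AddCommMonoid K] (e : α ≃ β) (he : ∀ x, labels (e x) = labels x)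
    (S : Finset ℕ) (f : β → K) : ∑ x ∈ onSet α S, f (e x) = ∑ y ∈ onSet β S, f y :=
  Finset.sum_equiv e (by simp [he]) fun _ _ => rfl

instance {m : ℕ} : LabeledClass (Fin m → α) where
  labels c := ∑ i, labels (c i)
  finite_labels_eq S := by
    refine (Set.Finite.pi fun _ : Fin m => S.powerset.finite_toSet.biUnion fun A _ =>
      finite_labels_eq (α := α) A).subset fun c hc i _ => ?_
    have hle : labels (c i) ≤ S.val := by
      rw [← show ∑ i, labels (c i) = S.val from hc]
      exact Finset.single_le_sum (f := fun j => labels (c j)) (fun _ _ => Multiset.zero_le _)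
        (Finset.mem_univ i)
    let A : Finset ℕ := ⟨labels (c i), Multiset.nodup_of_le hle S.nodup⟩
    have hA : A ∈ (S.powerset : Set (Finset ℕ)) :=
      Finset.mem_coe.2 (Finset.mem_powerset.2 (Finset.val_le_iff.1 hle))
    exact Set.mem_biUnion hA (show labels (c i) = A.val from rfl)

theorem labels_pi {m : ℕ} (c : Fin m → α) : labels c = ∑ i, labels (c i) := rfl

variable [Field K]

/-- Up to level `N`, the exponential generating function of the structures with weight `f`
is `φ`. -/
def HasEGF (N : ℕ) (f : α → K) (φ : PowerSeries K) : Prop :=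
  ∀ S : Finset ℕ, S.card ≤ N →
    ∑ x ∈ onSet α S, f x = (S.card.factorial : K) * coeff S.card φ

/-- Up to level `N`, the derivative of the exponential generating function of the structures with
weight `f` is `φ`. -/
def HasDerivEGF (N : ℕ) (f : α → K) (φ : PowerSeries K) : Prop :=
  ∀ (S : Finset ℕ) (n : ℕ), S.card = n + 1 → n ≤ N →
    ∑ x ∈ onSet α S, f x = (n.factorial : K) * coeff n φ

theorem HasEGF.mono {N M : ℕ} {f : α → K} {φ : PowerSeries K} (h : HasEGF N f φ) (hM : M ≤ N) :
    HasEGF M f φ := fun S hS => h S (hS.trans hM)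

theorem HasEGF.hasDerivEGF {N : ℕ} {f : α → K} {φ : PowerSeries K} (h : HasEGF (N + 1) f φ) :
    HasDerivEGF N f (derivative K φ) := by
  intro S n hS hn
  rw [h S (by lia), hS, coeff_derivative, Nat.factorial_succ]
  push_cast
  ring

theorem HasEGF.congr_equiv {N : ℕ} {f : β → K} {g : α → K} {φ : PowerSeries K} (h : HasEGF N f φ)
    (e : α ≃ β) (he : ∀ x, labels (e x) = labels x) (hg : ∀ x, f (e x) = g x) :
    HasEGF N g φ := by
  intro S hS
  rw [← h S hS, ← sum_onSet_equiv e he]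
  exact Finset.sum_congr rfl fun x _ => (hg x).symm

/-- The product rule for exponential generating functions: the number of subsets of size `j` is a
binomial coefficient, which cancels against the factorials. -/
theorem sum_powerset_factorial_mul_coeff [CharZero K] (φ ψ : PowerSeries K) (S : Finset ℕ) :
    ∑ A ∈ S.powerset, ((A.card.factorial : K) * coeff A.card φ) *
      (((S \ A).card.factorial : K) * coeff (S \ A).card ψ) =
      (S.card.factorial : K) * coeff S.card (φ * ψ) := by
  have h : ∀ A ∈ S.powerset, ((A.card.factorial : K) * coeff A.card φ) *
      (((S \ A).card.factorial : K) * coeff (S \ A).card ψ) =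
      (fun j => ((j.factorial : K) * coeff j φ) *
        (((S.card - j).factorial : K) * coeff (S.card - j) ψ)) A.card := fun A hA => by
    rw [Finset.card_sdiff_of_subset (Finset.mem_powerset.1 hA)]
  rw [Finset.sum_congr rfl h,
    Finset.sum_powerset_apply_card (fun j => ((j.factorial : K) * coeff j φ) *
        (((S.card - j).factorial : K) * coeff (S.card - j) ψ)), coeff_mul,
    Finset.Nat.sum_antidiagonal_eq_sum_range_succ (fun i j => coeff i φ * coeff j ψ),
    Finset.mul_sum]
  refine Finset.sum_congr rfl fun j hj => ?_
  have hj : j ≤ S.card := Nat.lt_succ_iff.1 (Finset.mem_range.1 hj)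
  rw [nsmul_eq_mul, ← Nat.choose_mul_factorial_mul_factorial hj]
  push_cast
  ring

theorem HasEGF.mul [CharZero K] {N : ℕ} {f : α → K} {g : β → K} {φ ψ : PowerSeries K}
    (hf : HasEGF N f φ) (hg : HasEGF N g ψ) :
    HasEGF N (fun p : α × β => f p.1 * g p.2) (φ * ψ) := by
  intro S hS
  rw [sum_onSet_prod S fun x y => f x * g y, ← sum_powerset_factorial_mul_coeff]
  refine Finset.sum_congr rfl fun A hA => ?_
  rw [← hf A ((Finset.card_le_card (Finset.mem_powerset.1 hA)).trans hS),
    ← hg (S \ A) ((Finset.card_le_card Finset.sdiff_subset).trans hS), Finset.sum_mul_sum]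

theorem hasEGF_one_of_labels_eq_zero {N : ℕ} {f : α → K} {e : α} (h : ∀ x : α, x = e)
    (h0 : labels e = 0) (hf : f e = 1) : HasEGF N f 1 := by
  intro S _
  rcases S.eq_empty_or_nonempty with rfl | hS
  · have : onSet α ∅ = {e} := by
      ext x
      simp [h x, h0]
    simp [this, hf]
  · have : onSet α S = ∅ := by
      refine Finset.eq_empty_of_forall_notMem fun x hx => ?_
      rw [mem_onSet, h x, h0, eq_comm, Finset.val_eq_zero] at hx
      exact hS.ne_empty hx
    simp [this, coeff_one, hS.ne_empty]

theorem HasEGF.pi [CharZero K] {N m : ℕ} {f : Fin m → α → K} {φ : Fin m → PowerSeries K}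
    (h : ∀ i, HasEGF N (f i) (φ i)) :
    HasEGF N (fun c : Fin m → α => ∏ i, f i (c i)) (∏ i, φ i) := by
  induction m with
  | zero =>
    rw [Finset.univ_eq_empty, Finset.prod_empty]
    exact hasEGF_one_of_labels_eq_zero (e := Fin.elim0) (fun _ => Subsingleton.elim _ _)
      (by simp [labels_pi]) (by simp)
  | succ m ih =>
    rw [Fin.prod_univ_succ]
    refine ((h 0).mul (ih fun i => h i.succ)).congr_equiv (Fin.consEquiv fun _ => α).symm ?_ ?_
    · intro c
      simp [labels_prod, labels_pi, Fin.sum_univ_succ, Fin.consEquiv, Fin.tail]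
    · intro c
      simp [Fin.prod_univ_succ, Fin.consEquiv, Fin.tail]

theorem HasEGF.pow [CharZero K] {N m : ℕ} {f : α → K} {φ : PowerSeries K} (h : HasEGF N f φ) :
    HasEGF N (fun c : Fin m → α => ∏ i, f (c i)) (φ ^ m) := by
  simpa using HasEGF.pi (m := m) fun _ => h

/-- Pairs of structures whose smallest label belongs to the first structure. -/
theorem sum_onSet_prod_min_mem [CharZero K] {n : ℕ} {f : α → K} {g : β → K} {φ ψ : PowerSeries K}
    (hf : HasDerivEGF n f φ) (hg : HasEGF n g ψ) {S : Finset ℕ} (hS : S.card = n + 1)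
    {s : ℕ} (hs : s ∈ S) :
    ∑ p ∈ onSet (α × β) S, (if s ∈ labels p.1 then f p.1 * g p.2 else 0) =
      (n.factorial : K) * coeff n (φ * ψ) := by
  have hcard : (S.erase s).card = n := by rw [Finset.card_erase_of_mem hs, hS]; rfl
  have hpow := sum_powerset_factorial_mul_coeff φ ψ (S.erase s)
  rw [hcard] at hpow
  rw [sum_onSet_prod S fun x y => if s ∈ labels x then f x * g y else 0,
    ← Finset.insert_erase hs, Finset.sum_powerset_insert (Finset.notMem_erase s S),
    Finset.insert_erase hs, ← hpow]
  -- Label sets of the first structure that miss `s` contribute nothing. The others are `insert s A`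
  -- with `A ⊆ S.erase s`; indexing them by `A`, one element smaller, is what makes the derivative
  -- `φ` appear.
  have hz : ∑ A ∈ (S.erase s).powerset, ∑ x ∈ onSet α A, ∑ y ∈ onSet β (S \ A),
      (if s ∈ labels x then f x * g y else 0) = 0 := by
    refine Finset.sum_eq_zero fun A hA => Finset.sum_eq_zero fun x hx =>
      Finset.sum_eq_zero fun y _ => if_neg ?_
    rw [mem_onSet.1 hx, Finset.mem_val]
    exact fun h => Finset.notMem_erase s S (Finset.mem_powerset.1 hA h)
  rw [hz, zero_add]
  refine Finset.sum_congr rfl fun A hA => ?_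
  have hA := Finset.mem_powerset.1 hA
  have hsA : s ∉ A := fun h => Finset.notMem_erase s S (hA h)
  have hAn : A.card ≤ n := hcard ▸ Finset.card_le_card hA
  have hsd : S \ insert s A = S.erase s \ A := by
    ext x
    simp only [Finset.mem_sdiff, Finset.mem_insert, Finset.mem_erase]
    tauto
  rw [hsd, ← hf (insert s A) A.card (Finset.card_insert_of_notMem hsA) hAn,
    ← hg (S.erase s \ A) ((Finset.card_le_card Finset.sdiff_subset).trans hcard.le),
    Finset.sum_mul_sum]
  refine Finset.sum_congr rfl fun x hx => Finset.sum_congr rfl fun y _ => if_pos ?_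
  rw [mem_onSet.1 hx]
  exact Finset.mem_insert_self s A

end LabeledClass

-- Single vertices, and the smallest label in a family

namespace LabeledClass

variable {α K : Type*} [LabeledClass α]

/-- A single vertex, which is identified with its label. -/
instance : LabeledClass ℕ where
  labels a := {a}
  finite_labels_eq S := by
    refine S.finite_toSet.subset fun a (ha : {a} = S.val) => ?_
    rw [Finset.mem_coe, ← Finset.mem_val, ← ha]
    exact Multiset.mem_singleton_self a

theorem labels_nat (a : ℕ) : labels a = {a} := rfl

theorem labels_eq_val_iff {p : ℕ × α} {S : Finset ℕ} :
    labels p = S.val ↔ p.1 ∈ S ∧ labels p.2 = (S.erase p.1).val := by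
  rw [labels_prod, labels_nat, Multiset.singleton_add, Finset.erase_val]
  constructor
  · intro h
    refine ⟨?_, ?_⟩
    · rw [← Finset.mem_val, ← h]
      exact Multiset.mem_cons_self _ _
    · rw [← h, Multiset.erase_cons_head]
  · rintro ⟨h, h'⟩
    rw [h', Multiset.cons_erase (Finset.mem_def.1 h)]

theorem sum_onSet_nat_prod [AddCommMonoid K] (S : Finset ℕ) (f : ℕ → α → K) :
    ∑ p ∈ onSet (ℕ × α) S, f p.1 p.2 = ∑ a ∈ S, ∑ x ∈ onSet α (S.erase a), f a x := by
  rw [Finset.sum_sigma']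
  refine Finset.sum_bij' (fun p _ => ⟨p.1, p.2⟩) (fun p _ => (p.1, p.2)) ?_ ?_ ?_ ?_ ?_
  · intro p hp
    simpa using labels_eq_val_iff.1 (mem_onSet.1 hp)
  · intro p hp
    refine mem_onSet.2 (labels_eq_val_iff.2 ?_)
    simpa using hp
  all_goals simp

theorem exists_mem_labels_of_mem {m : ℕ} {c : Fin m → α} {S : Finset ℕ} (hc : labels c = S.val)
    {s : ℕ} (hs : s ∈ S) : ∃ i, s ∈ labels (c i) ∧ ∀ j, s ∈ labels (c j) → j = i := by
  rw [← Finset.mem_val, ← hc, labels_pi] at hs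
  obtain ⟨i, -, hi⟩ := Multiset.mem_sum.1 hs
  refine ⟨i, hi, fun j hj => ?_⟩
  by_contra hij
  have hn : (labels c).Nodup := hc ▸ S.nodup
  have h1 := Multiset.nodup_iff_count_le_one.1 hn s
  rw [labels_pi, Multiset.count_sum'] at h1
  have h2 : ∑ l ∈ {i, j}, Multiset.count s (labels (c l)) ≤ _ :=
    Finset.sum_le_sum_of_subset (Finset.subset_univ _)
  rw [Finset.sum_pair (Ne.symm hij)] at h2
  have := Multiset.count_pos.2 hi
  have := Multiset.count_pos.2 hj
  lia

theorem mem_of_mem_labels {m : ℕ} {c : Fin m → α} {S : Finset ℕ} (hc : labels c = S.val)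
    {s : ℕ} {i : Fin m} (hs : s ∈ labels (c i)) : s ∈ S := by
  rw [← Finset.mem_val, ← hc, labels_pi]
  exact Multiset.mem_sum.2 ⟨i, Finset.mem_univ i, hs⟩

/-- Families of structures, with a weight that may depend on the component `i` which contains the
smallest label. -/
theorem sum_onSet_pi_min_mem [Field K] [CharZero K] {m n : ℕ} {f : α → K} {g : (Fin m → α) → K}
    {φ ψ : PowerSeries K} (hf : HasDerivEGF n f φ) (hg : HasEGF n g ψ) {S : Finset ℕ}
    (hS : S.card = n + 1) {s : ℕ} (hs : s ∈ S) (i : Fin (m + 1)) :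
    ∑ c ∈ onSet (Fin (m + 1) → α) S,
      (if s ∈ labels (c i) then f (c i) * g (i.removeNth c) else 0) =
      (n.factorial : K) * coeff n (φ * ψ) := by
  rw [← sum_onSet_prod_min_mem hf hg hS hs, ← sum_onSet_equiv (Fin.insertNthEquiv (fun _ => α) i)]
  · simp [Fin.insertNthEquiv]
  · intro p
    simp [labels_prod, labels_pi, Fin.sum_univ_succAbove _ i]

end LabeledClass

-- The trees

namespace MAryTree

open LabeledClass

variable {m : ℕ}

instance : LabeledClass (MAryTree m) where
  labels := labels
  finite_labels_eq S :=
    (finite_labels S S.card).subset fun T (hT : T.labels = S.val) => by simp [hT]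

theorem labeledClass_labels (T : MAryTree m) : LabeledClass.labels T = T.labels := rfl

theorem labeledClass_labels_pi (c : Fin m → MAryTree m) :
    LabeledClass.labels c = labelsBelow c := rfl

theorem onSet_empty : onSet (MAryTree m) ∅ = {leaf} := by
  ext T
  rcases T with _ | ⟨a, c⟩ <;> simp [labeledClass_labels, labels]

variable {K : Type*}

theorem sum_onSet_eq [AddCommMonoid K] {S : Finset ℕ} (hS : S.Nonempty) (f : MAryTree m → K) :
    ∑ T ∈ onSet (MAryTree m) S, f T =
      ∑ a ∈ S, ∑ c ∈ onSet (Fin m → MAryTree m) (S.erase a), f (node a c) := by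
  rw [← sum_onSet_nat_prod S fun a c => f (node a c)]
  have hl : ∀ p : ℕ × (Fin m → MAryTree m),
      LabeledClass.labels (node p.1 p.2) = LabeledClass.labels p := fun _ => rfl
  refine (Finset.sum_bij (fun p _ => node p.1 p.2) ?_ ?_ ?_ ?_).symm
  · intro p hp
    rwa [mem_onSet, hl, ← mem_onSet]
  · rintro ⟨a, c⟩ _ ⟨b, d⟩ _ h
    simpa using h
  · rintro (_ | ⟨a, c⟩) h
    · have h : 0 = S.val := mem_onSet.1 h
      exact absurd (Finset.val_eq_zero.1 h.symm) hS.ne_empty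
    · exact ⟨(a, c), by rwa [mem_onSet, ← hl, ← mem_onSet], rfl⟩
  · intros
    rfl

variable [Field K]

/-- The weight of a tree which marks the proper and the improper vertices. -/
def weight (u v : K) (T : MAryTree m) : K := v ^ (T.labels.card - T.prop) * u ^ T.prop

/-- The weight of a tree which marks the proper vertices, the improper vertices and the
components. -/
def compWeight (hm : 1 < m) (u v t : K) (T : MAryTree m) : K := weight u v T * t ^ T.comp hm

theorem weight_node (u v : K) (a : ℕ) (c : Fin m → MAryTree m) :
    weight u v (node a c) = (if RootProper a c then u else v) * ∏ i, weight u v (c i) := by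
  -- Truncated subtraction distributes over the sum only because `prop` never exceeds the number of
  -- labels.
  have h := Finset.sum_le_sum fun i (_ : i ∈ Finset.univ) => prop_le_card_labels (c i)
  have h' := Finset.sum_tsub_distrib Finset.univ
    fun i (_ : i ∈ Finset.univ) => prop_le_card_labels (c i)
  simp only [weight, prop, labels, Multiset.card_cons, Multiset.card_sum, Finset.prod_mul_distrib,
    Finset.prod_pow_eq_pow_sum]
  rw [h']
  split_ifs
  · rw [add_comm 1, Nat.add_sub_add_right, pow_succ]
    ring
  · rw [zero_add, Nat.succ_sub h, pow_succ]
    ring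

theorem comp_node (hm : 1 < m) (a : ℕ) (c : Fin m → MAryTree m) :
    (node a c).comp hm =
      (c (if TurnsAtRoot hm a c then ⟨1, hm⟩ else ⟨0, Nat.zero_lt_of_lt hm⟩)).comp hm + 1 := by
  simp only [comp, decomposingPath, List.length_cons]
  split_ifs <;> rfl

variable [CharZero K] {κ N : ℕ} {u v t : K} {φ ψ : PowerSeries K} {hm : 1 < m}

/-- Only the child entered by the decomposing path carries `t`, so it contributes `ψ` and every
other child contributes `φ`. -/
theorem hasEGF_path (h : HasEGF N (weight (m := m) u v) φ)
    (h' : HasEGF N (compWeight hm u v t) ψ) :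
    HasEGF N (fun c : Fin (κ + 1) → MAryTree m => (∏ i, weight u v (c i)) * t ^ (c 0).comp hm)
      (ψ * φ ^ κ) := by
  refine (h'.mul h.pow).congr_equiv (Fin.consEquiv fun _ => MAryTree m).symm ?_ ?_
  · intro c
    simp [labels_prod, labels_pi, Fin.sum_univ_succ, Fin.consEquiv, Fin.tail]
  · intro c
    simp [Fin.prod_univ_succ, Fin.consEquiv, Fin.tail, compWeight]
    ring

theorem sum_onSet_of_root_lt (h : HasEGF N (weight (m := κ + 2) u v) φ) {hm : 1 < κ + 2}
    (h' : HasEGF N (compWeight hm u v t) ψ) {S : Finset ℕ} (hS : S.card ≤ N) {a : ℕ}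
    (ha : ∀ x ∈ S, a < x) :
    ∑ c ∈ onSet (Fin (κ + 2) → MAryTree (κ + 2)) S, compWeight hm u v t (node a c) =
      u * t * ((S.card.factorial : K) * coeff S.card (ψ * φ ^ (κ + 1))) := by
  rw [← hasEGF_path h h' S hS, Finset.mul_sum]
  refine Finset.sum_congr rfl fun c hc => ?_
  have hp : RootProper a c := by
    intro x hx
    rw [← labeledClass_labels_pi, mem_onSet.1 hc] at hx
    exact ha x hx
  rw [compWeight, weight_node, if_pos hp, comp_node, if_neg fun h => h.1 hp, pow_succ]
  simp only [Fin.zero_eta]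
  ring

/-- The child holding the smallest label `s` gives `φ'`, in any of `κ + 2` positions. The path
avoids that child, so the other `κ + 1` children always give `ψ * φ ^ κ`. -/
theorem sum_onSet_of_lt_root {n : ℕ} (h : HasEGF (n + 1) (weight (m := κ + 2) u v) φ)
    {hm : 1 < κ + 2} (h' : HasEGF n (compWeight hm u v t) ψ) {S : Finset ℕ}
    (hS : S.card = n + 1) {a s : ℕ} (hs : s ∈ S) (ha : s < a) (hmin : ∀ x ∈ S, s ≤ x) :
    ∑ c ∈ onSet (Fin (κ + 2) → MAryTree (κ + 2)) S, compWeight hm u v t (node a c) =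
      v * t * ((κ + 2) * ((n.factorial : K) * coeff n (derivative K φ * (ψ * φ ^ κ)))) := by
  have hi := sum_onSet_pi_min_mem h.hasDerivEGF (hasEGF_path (κ := κ) (h.mono n.le_succ) h') hS hs
  have hsum : ((κ : K) + 2) * ((n.factorial : K) * coeff n (derivative K φ * (ψ * φ ^ κ))) =
      ∑ _i : Fin (κ + 2), (n.factorial : K) * coeff n (derivative K φ * (ψ * φ ^ κ)) := by
    simp
  rw [hsum, ← Finset.sum_congr rfl fun i _ => hi i, Finset.sum_comm, Finset.mul_sum]
  refine Finset.sum_congr rfl fun c hc => ?_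
  have hc := mem_onSet.1 hc
  obtain ⟨i, hsi, huniq⟩ := exists_mem_labels_of_mem hc hs
  have hp : ¬ RootProper a c := fun hp =>
    (hp s (mem_sum_labels.2 ⟨i, hsi⟩)).not_gt ha
  have hturn : TurnsAtRoot hm a c ↔ i = 0 := by
    constructor
    · rintro ⟨-, x, hx, hle⟩
      have h1 : x ≤ s := hle s (Multiset.mem_cons_of_mem (mem_sum_labels.2 ⟨i, hsi⟩))
      have h2 : s ≤ x := hmin x (mem_of_mem_labels hc hx)
      obtain rfl := h1.antisymm h2
      exact (huniq _ hx).symm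
    · rintro rfl
      refine ⟨hp, s, hsi, fun y hy => ?_⟩
      rcases Multiset.mem_cons.1 hy with rfl | hy
      · exact ha.le
      · obtain ⟨j, hj⟩ := mem_sum_labels.1 hy
        exact hmin y (mem_of_mem_labels hc hj)
  -- In both cases the path enters the first child once child `i` is removed, which is entry `0` of
  -- `i.removeNth c`.
  have hpath : (if TurnsAtRoot hm a c then ⟨1, hm⟩ else ⟨0, Nat.zero_lt_of_lt hm⟩ : Fin (κ + 2)) =
      i.succAbove 0 := by
    by_cases h0 : i = 0
    · rw [if_pos (hturn.2 h0), h0]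
      rfl
    · rw [if_neg (mt hturn.1 h0), Fin.succAbove_ne_zero_zero h0]
      rfl
  rw [Finset.sum_eq_single i (fun j _ hj => if_neg fun h => hj (huniq j h)) (by simp),
    if_pos hsi, compWeight, weight_node, if_neg hp, comp_node, hpath, pow_succ,
    Fin.prod_univ_succAbove _ i]
  simp only [Fin.removeNth]
  ring

/-- The recursive step for the exponential generating function of the trees. -/
theorem hasEGF_compWeight_succ {hm : 1 < κ + 2}
    (h : HasEGF N (weight (m := κ + 2) u v) (cayleySeries ((κ + 1) * u) ((κ + 2) * v) u))
    (h' : HasEGF N (compWeight (m := κ + 2) hm u v t)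
      (cayleySeries ((κ + 1) * u) ((κ + 2) * v) (t * u))) :
    HasEGF (N + 1) (compWeight (m := κ + 2) hm u v t)
      (cayleySeries ((κ + 1) * u) ((κ + 2) * v) (t * u)) := by
  intro S hS
  rw [factorial_mul_coeff_cayleySeries]
  rcases S.eq_empty_or_nonempty with rfl | hne
  · simp [onSet_empty, compWeight, weight, comp, decomposingPath, prop, labels, cayleyPoly]
  obtain ⟨n, hn⟩ := Nat.exists_eq_succ_of_ne_zero hne.card_pos.ne'
  have hmem := S.min'_mem hne
  have hle := S.min'_le
  set s := S.min' hne
  have hcard : ∀ a ∈ S, (S.erase a).card = n := fun a ha => by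
    rw [Finset.card_erase_of_mem ha, hn]
    rfl
  -- The root label is either the minimum `s` or one of the `n` other labels, which all contribute
  -- equally; the factor `n` becomes the `X` of the recurrence.
  rw [sum_onSet_eq hne, ← Finset.add_sum_erase _ _ hmem,
    sum_onSet_of_root_lt h h' (by rw [hcard s hmem]; lia), hcard s hmem, hn, Nat.succ_eq_add_one,
    cayleyPoly_succ_eq_coeff, cayleyDerivSeries_eq, cayleySeries_pow, cayleySeries_mul]
  · rcases n with _ | n
    · rw [Finset.card_eq_zero.1 (hcard s hmem)]
      simp [coeff_zero_eq_constantCoeff, constantCoeff_cayleySeries]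
      ring
    · rw [Finset.sum_congr rfl fun a ha => sum_onSet_of_lt_root (h.mono (by lia))
        (h'.mono (by lia)) (hcard a (Finset.mem_of_mem_erase ha))
        (Finset.mem_erase.2 ⟨(Finset.ne_of_mem_erase ha).symm, hmem⟩)
        (lt_of_le_of_ne (hle a (Finset.mem_of_mem_erase ha)) (Finset.ne_of_mem_erase ha).symm)
        (fun x hx => hle x (Finset.mem_of_mem_erase hx))]
      rw [derivative_cayleySeries, cayleySeries_pow, cayleySeries_mul, mul_assoc (C u),
        cayleyDerivSeries_mul, Finset.sum_const, hcard s hmem, map_add, coeff_C_mul, coeff_C_mul,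
        coeff_succ_X_mul, nsmul_eq_mul, Nat.factorial_succ]
      -- Both contributions have third parameter `c + a` for `c = t u` and `a = (κ + 1) u`, as the
      -- recurrence requires.
      have e1 : t * u + ((κ + 1 : ℕ) : K) * u = t * u + (κ + 1) * u := by push_cast; ring
      have e2 : u + (t * u + (κ : K) * u) = t * u + (κ + 1) * u := by ring
      rw [e1, e2]
      push_cast
      ring
  · intro x hx
    exact lt_of_le_of_ne (hle x (Finset.mem_of_mem_erase hx)) (Finset.ne_of_mem_erase hx).symm

/-- At `t = 1` the series `ψ` and `φ` coincide, so the recursive step closes on itself; the general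
`t` then uses this case as input. -/
theorem hasEGF_weight (κ : ℕ) (u v : K) (N : ℕ) :
    HasEGF N (weight (m := κ + 2) u v) (cayleySeries ((κ + 1) * u) ((κ + 2) * v) u) := by
  have hc : compWeight (m := κ + 2) (by lia) u v 1 = weight u v := by
    ext T
    simp [compWeight]
  induction N with
  | zero =>
    intro S hS
    obtain rfl := Finset.card_eq_zero.1 (Nat.le_zero.1 hS)
    simp [onSet_empty, weight, prop, labels, constantCoeff_cayleySeries]
  | succ N ih =>
    have := hasEGF_compWeight_succ (hm := by lia) (t := 1) ih (by rwa [hc, one_mul])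
    rwa [hc, one_mul] at this

theorem hasEGF_compWeight (κ : ℕ) (hm : 1 < κ + 2) (u v t : K) (N : ℕ) :
    HasEGF N (compWeight hm u v t) (cayleySeries ((κ + 1) * u) ((κ + 2) * v) (t * u)) := by
  induction N with
  | zero =>
    intro S hS
    obtain rfl := Finset.card_eq_zero.1 (Nat.le_zero.1 hS)
    simp [onSet_empty, compWeight, comp, decomposingPath, weight, prop, labels,
      constantCoeff_cayleySeries]
  | succ N ih => exact hasEGF_compWeight_succ (hasEGF_weight κ u v N) ih

end MAryTree

-- Left-right minima of rearrangements

section LeftRightMinima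

/-- A form with plain natural indices, suited to appending entries; all indices are in range, so the
default `0` is never read. -/
theorem leftRightMinima_eq_sum (l : List ℕ) :
    leftRightMinima l =
      ∑ i ∈ Finset.range l.length, if ∀ j < i, l.getD i 0 < l.getD j 0 then 1 else 0 := by
  rw [leftRightMinima, Finset.card_filter,
    ← Fin.sum_univ_eq_sum_range (fun i => if ∀ j < i, l.getD i 0 < l.getD j 0 then 1 else 0)]
  refine Finset.sum_congr rfl fun i _ => if_congr ?_ rfl rfl
  constructor
  · intro h j hj
    rw [List.getD_eq_getElem _ _ i.2, List.getD_eq_getElem _ _ (hj.trans i.2)]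
    exact h ⟨j, hj.trans i.2⟩ hj
  · intro h j hj
    have := h j hj
    rwa [List.getD_eq_getElem _ _ i.2, List.getD_eq_getElem _ _ j.2] at this

theorem leftRightMinima_concat (l : List ℕ) (a : ℕ) :
    leftRightMinima (l ++ [a]) = leftRightMinima l + if ∀ x ∈ l, a < x then 1 else 0 := by
  rw [leftRightMinima_eq_sum, leftRightMinima_eq_sum, List.length_append, List.length_singleton,
    Finset.sum_range_succ]
  congr 1
  · refine Finset.sum_congr rfl fun i hi => if_congr ?_ rfl rfl
    have hi := Finset.mem_range.1 hi
    refine forall₂_congr fun j hj => ?_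
    rw [List.getD_append _ _ _ _ hi, List.getD_append _ _ _ _ (hj.trans hi)]
  · refine if_congr ?_ rfl rfl
    rw [List.getD_append_right _ _ _ _ le_rfl, List.forall_mem_iff_getElem]
    refine forall₂_congr fun j hj => ?_
    rw [List.getD_append _ _ _ _ hj, List.getD_eq_getElem _ _ hj]
    simp

/-- Once `a` has occurred, no later entry that is at least `a` can be a new minimum. -/
theorem leftRightMinima_append_cons {l r : List ℕ} {a : ℕ} (hl : ∀ x ∈ l, a < x)
    (hr : ∀ x ∈ r, a ≤ x) : leftRightMinima (l ++ a :: r) = leftRightMinima l + 1 := by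
  induction r using List.reverseRecOn with
  | nil => rw [leftRightMinima_concat, if_pos hl]
  | append_singleton r b ih =>
    rw [← List.cons_append, ← List.append_assoc, leftRightMinima_concat,
      ih fun x hx => hr x (List.mem_append_left _ hx), if_neg]
    intro h
    exact (h a (by simp)).not_ge (hr b (by simp))

open Classical in
/-- The distribution of the left-right minima over the rearrangements of a multiset does not depend
on the keys which are used to compare its elements. -/
theorem sum_lists_pow_leftRightMinima {α R : Type*} [CommSemiring R] (key : α → ℕ) (t : R)
    (M : Multiset α) (hM : (M.map key).Nodup) :
    ∑ l ∈ M.lists.toFinset, t ^ leftRightMinima (l.map key) =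
      ∏ i ∈ Finset.range M.card, (t + i) := by
  induction h : M.card generalizing M with
  | zero =>
    obtain rfl := Multiset.card_eq_zero.1 h
    have : (0 : Multiset α).lists.toFinset = {[]} := by
      ext l
      rw [Multiset.mem_toFinset, Multiset.mem_lists_iff]
      simp [eq_comm]
    simp [this, leftRightMinima_eq_sum]
  | succ n ih =>
    have hnd : M.Nodup := Multiset.Nodup.of_map key hM
    have herase : ∀ a ∈ M.toFinset, (M.erase a).card = n := fun a ha => by
      rw [Multiset.card_erase_of_mem (Multiset.mem_toFinset.1 ha), h]
      rfl
    -- Remove the last entry `a`: it affects no earlier minimum, and is itself one exactly when its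
    -- key is the smallest in `M`.
    have hsplit : ∑ l ∈ M.lists.toFinset, t ^ leftRightMinima (l.map key) =
        ∑ a ∈ M.toFinset, ∑ l ∈ (M.erase a).lists.toFinset,
          (if ∀ x ∈ M.erase a, key a < key x then t else 1) *
            t ^ leftRightMinima (l.map key) := by
      rw [Finset.sum_sigma']
      symm
      refine Finset.sum_bij (fun p _ => p.2 ++ [p.1]) ?_ ?_ ?_ ?_
      · rintro ⟨a, l⟩ hp
        simp only [Finset.mem_sigma, Multiset.mem_toFinset, Multiset.mem_lists_iff] at hp ⊢
        rw [← Multiset.cons_erase hp.1, hp.2]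
        exact Multiset.coe_eq_coe.2 (List.perm_append_singleton a l).symm
      · rintro ⟨a, l⟩ _ ⟨b, l'⟩ _ heq
        obtain ⟨rfl, h2⟩ := List.append_inj' heq rfl
        simpa using h2
      · intro l hl
        rw [Multiset.mem_toFinset, Multiset.mem_lists_iff] at hl
        rcases l.eq_nil_or_concat' with rfl | ⟨l, a, rfl⟩
        · rw [hl] at h
          simp at h
        · have hM' : M = a ::ₘ (l : Multiset α) :=
            hl.trans (Multiset.coe_eq_coe.2 (List.perm_append_singleton a l))
          refine ⟨⟨a, l⟩, ?_, by simp⟩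
          simp only [Finset.mem_sigma, Multiset.mem_toFinset, Multiset.mem_lists_iff]
          rw [hM', Multiset.erase_cons_head]
          exact ⟨Multiset.mem_cons_self _ _, rfl⟩
      · rintro ⟨a, l⟩ hp
        simp only [Finset.mem_sigma, Multiset.mem_toFinset, Multiset.mem_lists_iff] at hp
        have e : M.erase a = (l : Multiset α) := hp.2
        rw [List.map_append, List.map_singleton, leftRightMinima_concat, e, pow_add, mul_comm]
        simp only [List.forall_mem_map, Multiset.mem_coe]
        split_ifs <;> simp
    have hinner : ∀ a ∈ M.toFinset, ∑ l ∈ (M.erase a).lists.toFinset,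
        t ^ leftRightMinima (l.map key) = ∏ i ∈ Finset.range n, (t + i) := fun a ha =>
      ih _ (Multiset.nodup_of_le (Multiset.map_le_map (Multiset.erase_le a M)) hM) (herase a ha)
    rw [hsplit]
    simp_rw [← Finset.mul_sum]
    rw [Finset.sum_congr rfl fun a ha => by rw [hinner a ha], ← Finset.sum_mul,
      Finset.prod_range_succ, mul_comm]
    congr 1
    have hne : M.toFinset.Nonempty := by
      rw [Multiset.toFinset_nonempty]
      rintro rfl
      simp at h
    -- The unique element with minimal key contributes `t` as last entry and each of the `n` others
    -- contributes `1`, giving the factor `t + n`.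
    obtain ⟨b, hb, hmin⟩ := M.toFinset.exists_min_image key hne
    have hinj : ∀ x ∈ M, ∀ y ∈ M, key x = key y → x = y :=
      Multiset.inj_on_of_nodup_map hM
    rw [← Finset.add_sum_erase _ _ hb, if_pos, Finset.sum_congr rfl (g := fun _ => (1 : R))]
    · rw [Finset.sum_const, Finset.card_erase_of_mem hb, Multiset.toFinset_card_of_nodup hnd, h]
      simp
    · intro a ha
      refine if_neg fun hcon => ?_
      have hab := Finset.ne_of_mem_erase ha
      exact (hcon b ((Multiset.mem_erase_of_ne hab.symm).2 (Multiset.mem_toFinset.1 hb))).not_ge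
        (hmin a (Finset.mem_of_mem_erase ha))
    · intro x hx
      rw [hnd.mem_erase_iff] at hx
      refine lt_of_le_of_ne (hmin x (Multiset.mem_toFinset.2 hx.2)) fun he => hx.1 ?_
      exact hinj x hx.2 b (Multiset.mem_toFinset.1 hb) he.symm

end LeftRightMinima

-- The forests

namespace ColoredForest

open LabeledClass

variable {k : ℕ}

theorem labels_eq_sum (F : List (ColoredTree k)) :
    labels F = (F.map ColoredTree.labels).sum := by
  induction F with
  | nil => rfl
  | cons T F ih => rw [labels, ih, List.map_cons, List.sum_cons]

theorem labels_append (F G : List (ColoredTree k)) : labels (F ++ G) = labels F + labels G := by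
  simp [labels_eq_sum]

theorem mem_labels {F : List (ColoredTree k)} {x : ℕ} :
    x ∈ labels F ↔ ∃ T ∈ F, x ∈ T.labels := by
  induction F with
  | nil => simp [labels]
  | cons T F ih => simp [labels, ih]

instance : LabeledClass (List (ColoredTree k)) where
  labels := labels
  finite_labels_eq S :=
    (finite_labels S S.card).subset fun F (hF : labels F = S.val) => by simp [hF]

instance : LabeledClass (ColoredTree k) where
  labels := ColoredTree.labels
  finite_labels_eq S := by
    refine Set.Finite.of_finite_image (f := fun T => [T])
      ((finite_labels_eq (α := List (ColoredTree k)) S).subset ?_) (by simp [Set.InjOn])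
    rintro _ ⟨T, hT, rfl⟩
    exact (add_zero _).trans hT

theorem labeledClass_labels (F : List (ColoredTree k)) : LabeledClass.labels F = labels F := rfl

theorem onSet_empty : onSet (List (ColoredTree k)) ∅ = {[]} := by
  ext F
  rcases F with _ | ⟨⟨a, c⟩, F⟩ <;>
    simp [labeledClass_labels, labels, ColoredTree.labels]

/-- The smallest label of a tree. -/
noncomputable def _root_.ColoredTree.minLabel (T : ColoredTree k) : ℕ := sInf {x | x ∈ T.labels}

theorem root_mem_labels (T : ColoredTree k) : T.root ∈ T.labels := by
  rcases T with ⟨a, c⟩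
  simp [ColoredTree.root, ColoredTree.labels]

theorem minLabel_mem_labels (T : ColoredTree k) : T.minLabel ∈ T.labels :=
  Nat.sInf_mem (s := {x | x ∈ T.labels}) ⟨_, root_mem_labels T⟩

theorem nodup_map_of_mem_labels {key : ColoredTree k → ℕ} (hkey : ∀ T, key T ∈ T.labels)
    {F : List (ColoredTree k)} (hF : (labels F).Nodup) : (F.map key).Nodup := by
  induction F with
  | nil => simp
  | cons T F ih =>
    rw [labels, Multiset.nodup_add] at hF
    rw [List.map_cons, List.nodup_cons]
    refine ⟨fun h => ?_, ih hF.2.1⟩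
    obtain ⟨T', hT', he⟩ := List.mem_map.1 h
    exact Multiset.disjoint_left.1 hF.2.2 (hkey T) (he ▸ mem_labels.2 ⟨T', hT', hkey T'⟩)

/-- Group forests by their multiset of trees. Each group consists of all rearrangements, the product
of weights is constant on it, and the keys are distinct because the trees have disjoint label sets.
-/
theorem sum_onSet_leftRightMinima_congr {R : Type*} [CommSemiring R] (f : ColoredTree k → R)
    {key key' : ColoredTree k → ℕ} (hkey : ∀ T, key T ∈ T.labels)
    (hkey' : ∀ T, key' T ∈ T.labels) (t : R) (S : Finset ℕ) :
    ∑ F ∈ onSet (List (ColoredTree k)) S, (F.map f).prod * t ^ leftRightMinima (F.map key) =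
      ∑ F ∈ onSet (List (ColoredTree k)) S,
        (F.map f).prod * t ^ leftRightMinima (F.map key') := by
  classical
  let g : List (ColoredTree k) → Multiset (ColoredTree k) := fun F => F
  have hg : ∀ F ∈ onSet (List (ColoredTree k)) S,
      g F ∈ (onSet (List (ColoredTree k)) S).image g := fun F hF => Finset.mem_image_of_mem g hF
  rw [← Finset.sum_fiberwise_of_maps_to hg, ← Finset.sum_fiberwise_of_maps_to hg]
  refine Finset.sum_congr rfl fun M hM => ?_
  obtain ⟨F₀, hF₀, rfl⟩ := Finset.mem_image.1 hM
  have hF₀ : labels F₀ = S.val := mem_onSet.1 hF₀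
  have hfib : {F ∈ onSet (List (ColoredTree k)) S | g F = g F₀} = (g F₀).lists.toFinset := by
    ext F
    rw [Finset.mem_filter, mem_onSet, Multiset.mem_toFinset, Multiset.mem_lists_iff]
    refine ⟨fun h => h.2.symm, fun h => ⟨?_, h.symm⟩⟩
    have hperm : List.Perm F₀ F := Multiset.coe_eq_coe.1 h
    rw [labeledClass_labels, ← hF₀, labels_eq_sum, labels_eq_sum]
    exact ((hperm.map _).sum_eq).symm
  have hprod : ∀ F ∈ (g F₀).lists.toFinset, (F.map f).prod = (F₀.map f).prod := by
    intro F hF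
    rw [Multiset.mem_toFinset, Multiset.mem_lists_iff] at hF
    have hperm : List.Perm F₀ F := Multiset.coe_eq_coe.1 hF
    exact ((hperm.map _).prod_eq).symm
  have hnd : ∀ {key : ColoredTree k → ℕ}, (∀ T, key T ∈ T.labels) →
      ((g F₀).map key).Nodup := fun h =>
    Multiset.coe_nodup.2 (nodup_map_of_mem_labels h (hF₀ ▸ S.nodup))
  rw [hfib, Finset.sum_congr rfl fun F hF => by rw [hprod F hF], ← Finset.mul_sum,
    sum_lists_pow_leftRightMinima key t _ (hnd hkey),
    Finset.sum_congr rfl (fun F hF => by rw [hprod F hF]), ← Finset.mul_sum,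
    sum_lists_pow_leftRightMinima key' t _ (hnd hkey')]

/-- Splitting a forest at the tree that contains a given label. -/
theorem sum_onSet_split {R : Type*} [AddCommMonoid R] (f : List (ColoredTree k) → R)
    {S : Finset ℕ} {s : ℕ} (hs : s ∈ S) :
    ∑ F ∈ onSet (List (ColoredTree k)) S, f F =
      ∑ p ∈ onSet (ColoredTree k × (List (ColoredTree k) × List (ColoredTree k))) S,
        if s ∈ LabeledClass.labels p.1 then f (p.2.1 ++ p.1 :: p.2.2) else 0 := by
  have hl : ∀ (T : ColoredTree k) (L R : List (ColoredTree k)),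
      LabeledClass.labels (T, (L, R)) = labels (L ++ T :: R) := fun T L R => by
    rw [labels_append, labels, ← add_assoc, add_comm (labels L), add_assoc]
    rfl
  rw [← Finset.sum_filter]
  refine (Finset.sum_bij (fun p _ => p.2.1 ++ p.1 :: p.2.2) ?_ ?_ ?_ fun _ _ => rfl).symm
  · rintro ⟨T, L, R⟩ hp
    have := mem_onSet.1 (Finset.mem_filter.1 hp).1
    rw [hl] at this
    exact mem_onSet.2 this
  · rintro ⟨T, L, R⟩ hp ⟨T', L', R'⟩ hp' he
    obtain ⟨h1, h2⟩ := Finset.mem_filter.1 hp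
    have h3 : s ∈ T'.labels := (Finset.mem_filter.1 hp').2
    have hn : (LabeledClass.labels (T, (L, R))).Nodup := (mem_onSet.1 h1) ▸ S.nodup
    have hd := Multiset.disjoint_left.1 (Multiset.nodup_add.1 hn).2.2 h2
    have hd : s ∉ labels L + labels R := hd
    rw [Multiset.mem_add, not_or] at hd
    -- The splitting is unique because no tree of `L` or `R` contains `s`.
    obtain ⟨rfl, rfl, rfl⟩ := (List.append_cons_inj_of_notMem
      (fun h => hd.1 (mem_labels.2 ⟨T', h, h3⟩)) (fun h => hd.2 (mem_labels.2 ⟨T', h, h3⟩))).1 he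
    rfl
  · intro F hF
    have hF : labels F = S.val := mem_onSet.1 hF
    have hsF : s ∈ labels F := hF ▸ hs
    obtain ⟨T, hT, hsT⟩ := mem_labels.1 hsF
    obtain ⟨L, R, rfl⟩ := List.append_of_mem hT
    exact ⟨(T, (L, R)), Finset.mem_filter.2 ⟨mem_onSet.2 ((hl T L R).trans hF), hsT⟩, rfl⟩

/-- Compared by smallest labels, `T` has the smallest key of all: it is a minimum and nothing in `R`
is. Roots as keys would not give this. -/
theorem leftRightMinima_map_minLabel {S : Finset ℕ} {s : ℕ} (hmin : ∀ x ∈ S, s ≤ x)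
    {T : ColoredTree k} {L R : List (ColoredTree k)} (hS : labels (L ++ T :: R) = S.val)
    (hs : s ∈ T.labels) :
    leftRightMinima ((L ++ T :: R).map ColoredTree.minLabel) =
      leftRightMinima (L.map ColoredTree.minLabel) + 1 := by
  have hle : ∀ T' ∈ L ++ T :: R, ∀ x ∈ T'.labels, s ≤ x := fun T' hT' x hx =>
    hmin x (by rw [Finset.mem_def, ← hS]; exact mem_labels.2 ⟨T', hT', hx⟩)
  have hT : T.minLabel = s :=
    le_antisymm (Nat.sInf_le hs) (hle T (by simp) _ (minLabel_mem_labels T))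
  have hn : (labels (L ++ T :: R)).Nodup := hS ▸ S.nodup
  have hk := nodup_map_of_mem_labels minLabel_mem_labels hn
  rw [List.map_append, List.map_cons] at hk ⊢
  refine leftRightMinima_append_cons (fun x hx => ?_) fun x hx => ?_
  · have hne : x ≠ T.minLabel := by
      rintro rfl
      exact (List.nodup_append.1 hk).2.2 _ hx _ (List.mem_cons_self ..) rfl
    obtain ⟨T', hT', rfl⟩ := List.mem_map.1 hx
    refine lt_of_le_of_ne ?_ hne.symm
    rw [hT]
    exact hle T' (List.mem_append_left _ hT') _ (minLabel_mem_labels T')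
  · obtain ⟨T', hT', rfl⟩ := List.mem_map.1 hx
    rw [hT]
    exact hle T' (by simp [hT']) _ (minLabel_mem_labels T')

variable {K : Type*} [Field K]

/-- The weight of a tree which marks the proper and the improper vertices. -/
def treeWeight (u v : K) (T : ColoredTree k) : K := u ^ (T.labels.card - T.prop) * v ^ T.prop

/-- The weight of a forest which marks the proper and the improper vertices. -/
def weight (u v : K) (F : List (ColoredTree k)) : K := (F.map (treeWeight u v)).prod

theorem weight_eq (u v : K) (F : List (ColoredTree k)) :
    weight u v F = u ^ ((labels F).card - prop F) * v ^ prop F := by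
  induction F with
  | nil => simp [weight, prop, labels]
  | cons T F ih =>
    have h1 := tree_prop_le T
    have h2 := prop_le_card_labels F
    have e : (labels (T :: F)).card - prop (T :: F) =
        (T.labels.card - T.prop) + ((labels F).card - prop F) := by
      simp only [labels, prop, Multiset.card_add]
      lia
    rw [e, weight, List.map_cons, List.prod_cons, ← weight, ih, treeWeight, prop, pow_add, pow_add]
    ring

theorem treeWeight_node (u v : K) (a : ℕ) (c : Fin k → List (ColoredTree k)) :
    treeWeight u v (.node a c) =
      (if ∀ x ∈ ColoredTree.labelsBelow c, a < x then v else u) * ∏ i, weight u v (c i) := by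
  have h := Finset.sum_le_sum fun i (_ : i ∈ Finset.univ) => prop_le_card_labels (c i)
  have h' := Finset.sum_tsub_distrib Finset.univ
    fun i (_ : i ∈ Finset.univ) => prop_le_card_labels (c i)
  simp only [treeWeight, weight_eq, ColoredTree.prop, ColoredTree.labels, Multiset.card_cons,
    Multiset.card_sum, Finset.prod_mul_distrib, Finset.prod_pow_eq_pow_sum]
  rw [h']
  split_ifs
  · rw [add_comm 1, Nat.add_sub_add_right, pow_succ]
    ring
  · rw [zero_add, Nat.succ_sub h, pow_succ]
    ring

variable [CharZero K] {N : ℕ} {u v t : K}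

/-- Below the root hang `k` independent forests, with series `φ^k = A_{kv}`. The smallest root label
gives weight `v`; the `n` other choices give `u` each, hence `u X (φ^k)'`. -/
theorem hasDerivEGF_treeWeight
    (h : HasEGF N (weight (k := k) u v) (cayleySeries ((k + 1) * v) (k * u) v)) :
    HasDerivEGF N (treeWeight (k := k) u v)
      (C v * (cayleySeries ((k + 1) * v) (k * u) (k * v) +
        C (k * u) * (X * cayleyDerivSeries ((k + 1) * v) (k * u) (k * v)))) := by
  intro S n hS hn
  have hne : S.Nonempty := Finset.card_pos.1 (by lia)
  have hmem := S.min'_mem hne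
  have hle := S.min'_le
  set s := S.min' hne
  let e : ColoredTree k ≃ ℕ × (Fin k → List (ColoredTree k)) :=
    ⟨fun | .node a c => (a, c), fun p => .node p.1 p.2, fun | .node _ _ => rfl, fun _ => rfl⟩
  have hcard : ∀ a ∈ S, (S.erase a).card = n := fun a ha => by
    rw [Finset.card_erase_of_mem ha, hS]
    rfl
  have hin : ∀ a ∈ S, ∑ c ∈ onSet (Fin k → List (ColoredTree k)) (S.erase a),
      treeWeight u v (.node a c) = (if a = s then v else u) *
        ((n.factorial : K) * coeff n (cayleySeries ((k + 1) * v) (k * u) (k * v))) := by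
    intro a ha
    have hp := h.pow (m := k) (S.erase a) (by rw [hcard a ha]; exact hn)
    rw [hcard a ha, cayleySeries_pow] at hp
    rw [← hp, Finset.mul_sum]
    refine Finset.sum_congr rfl fun c hc => ?_
    have hc : ColoredTree.labelsBelow c = (S.erase a).val := mem_onSet.1 hc
    rw [treeWeight_node]
    congr 1
    refine if_congr ?_ rfl rfl
    rw [hc]
    constructor
    · intro hlt
      by_contra hne
      exact (hlt s (Finset.mem_erase.2 ⟨Ne.symm hne, hmem⟩)).not_ge (hle a ha)
    · rintro rfl x hx
      have hx := Finset.mem_erase.1 hx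
      exact lt_of_le_of_ne (hle x hx.2) hx.1.symm
  have hlab : ∀ p, LabeledClass.labels (e.symm p) = LabeledClass.labels p := fun _ => rfl
  rw [← sum_onSet_equiv e.symm hlab]
  refine (sum_onSet_nat_prod S fun a c => treeWeight u v (.node a c)).trans ?_
  rw [Finset.sum_congr rfl hin,
    ← Finset.sum_mul, ← Finset.add_sum_erase _ _ hmem, if_pos rfl,
    Finset.sum_congr rfl fun a ha => if_neg (Finset.ne_of_mem_erase ha), Finset.sum_const,
    hcard s hmem, nsmul_eq_mul, coeff_C_mul, map_add, coeff_C_mul]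
  rcases n with _ | n
  · simp
  · have hd := congrArg (coeff n) (derivative_cayleySeries ((k + 1) * v) (k * u) (k * v))
    rw [coeff_derivative, coeff_C_mul] at hd
    rw [coeff_succ_X_mul]
    push_cast
    linear_combination ((n + 1).factorial : K) * u * hd

/-- The recursive step for the exponential generating function of the forests. -/
theorem hasEGF_weight_mul_pow_succ
    (h : HasEGF N (weight (k := k) u v) (cayleySeries ((k + 1) * v) (k * u) v))
    (h' : HasEGF N
      (fun F : List (ColoredTree k) =>
        weight u v F * t ^ leftRightMinima (F.map ColoredTree.minLabel))
      (cayleySeries ((k + 1) * v) (k * u) (t * v))) :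
    HasEGF (N + 1)
      (fun F : List (ColoredTree k) =>
        weight u v F * t ^ leftRightMinima (F.map ColoredTree.minLabel))
      (cayleySeries ((k + 1) * v) (k * u) (t * v)) := by
  intro S hS
  rw [factorial_mul_coeff_cayleySeries]
  rcases S.eq_empty_or_nonempty with rfl | hne
  · simp [onSet_empty, weight, leftRightMinima_eq_sum, cayleyPoly]
  obtain ⟨n, hn⟩ := Nat.exists_eq_succ_of_ne_zero hne.card_pos.ne'
  have hmem := S.min'_mem hne
  have hle := S.min'_le
  set s := S.min' hne
  have hnN : n ≤ N := by lia
  -- The tree with the smallest label gives the derivative of the tree series, `L` keeps its minima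
  -- and gives `ψ`, and `R` contributes no minima and gives `φ`.
  have hmain := sum_onSet_prod_min_mem
    (fun A j hA hj => hasDerivEGF_treeWeight h A j hA (hj.trans hnN))
    ((h'.mono hnN).mul (h.mono hnN)) hn hmem
  rw [sum_onSet_split _ hmem, hn, Nat.succ_eq_add_one, cayleyPoly_succ_eq_coeff,
    cayleyDerivSeries_eq]
  have hser : C v * (cayleySeries ((k + 1) * v) (k * u) (k * v) +
        C (k * u) * (X * cayleyDerivSeries ((k + 1) * v) (k * u) (k * v))) *
      (cayleySeries ((k + 1) * v) (k * u) (t * v) * cayleySeries ((k + 1) * v) (k * u) v) =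
      C v * (cayleySeries ((k + 1) * v) (k * u) (t * v + (k + 1) * v) +
        C (k * u) * (X * cayleyDerivSeries ((k + 1) * v) (k * u) (t * v + (k + 1) * v))) := by
    have e : t * v + (k + 1) * v = k * v + (t * v + v) := by ring
    rw [cayleySeries_mul, e, ← cayleySeries_mul _ _ (k * v), ← cayleyDerivSeries_mul _ _ (k * v)]
    ring
  rw [hser, coeff_C_mul] at hmain
  rw [show ∀ x : K, t * v * ((n.factorial : K) * x) = t * ((n.factorial : K) * (v * x)) by
    intro x; ring, ← hmain, Finset.mul_sum]
  refine Finset.sum_congr rfl fun p hp => ?_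
  obtain ⟨T, L, R⟩ := p
  by_cases hsT : s ∈ LabeledClass.labels T
  · have hlab : labels (L ++ T :: R) = S.val := by
      rw [← mem_onSet.1 hp, labels_append, labels, ← add_assoc, add_comm (labels L), add_assoc]
      rfl
    rw [if_pos hsT, if_pos hsT, leftRightMinima_map_minLabel hle hlab hsT, pow_succ]
    simp only [weight, List.map_append, List.map_cons, List.prod_append, List.prod_cons]
    ring
  · rw [if_neg hsT, if_neg hsT, mul_zero]

theorem hasEGF_weight (k : ℕ) (u v : K) (N : ℕ) :
    HasEGF N (weight (k := k) u v) (cayleySeries ((k + 1) * v) (k * u) v) := by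
  induction N with
  | zero =>
    intro S hS
    obtain rfl := Finset.card_eq_zero.1 (Nat.le_zero.1 hS)
    simp [onSet_empty, weight, constantCoeff_cayleySeries]
  | succ N ih =>
    simpa using hasEGF_weight_mul_pow_succ (t := 1) ih (by simpa using ih)

theorem hasEGF_weight_mul_pow_comp (k : ℕ) (u v t : K) (N : ℕ) :
    HasEGF N (fun F : List (ColoredTree k) => weight u v F * t ^ comp F)
      (cayleySeries ((k + 1) * v) (k * u) (t * v)) := by
  intro S hS
  have h : HasEGF N
      (fun F : List (ColoredTree k) =>
        weight u v F * t ^ leftRightMinima (F.map ColoredTree.minLabel))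
      (cayleySeries ((k + 1) * v) (k * u) (t * v)) := by
    clear hS
    induction N with
    | zero =>
      intro S hS
      obtain rfl := Finset.card_eq_zero.1 (Nat.le_zero.1 hS)
      simp [onSet_empty, weight, leftRightMinima_eq_sum, constantCoeff_cayleySeries]
    | succ N ih => exact hasEGF_weight_mul_pow_succ (hasEGF_weight k u v N) ih
  rw [← h S hS]
  exact sum_onSet_leftRightMinima_congr (treeWeight u v) root_mem_labels minLabel_mem_labels t S

end ColoredForest

-- From fields to arbitrary commutative rings

theorem map_cayleyPoly {R S : Type*} [CommRing R] [CommRing S] (f : R →+* S) (n : ℕ) (a b c : R) :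
    f (cayleyPoly n a b c) = cayleyPoly n (f a) (f b) (f c) := by
  simp [cayleyPoly, apply_ite f, map_prod]

namespace LabeledClass

theorem sum_subtype_eq_sum_onSet {α M : Type*} [LabeledClass α] [AddCommMonoid M] (S : Finset ℕ)
    [Fintype {x : α // labels x = S.val}] (f : α → M) :
    ∑ x : {x : α // labels x = S.val}, f x.1 = ∑ x ∈ onSet α S, f x :=
  (Finset.sum_subtype (onSet α S) (fun _ => mem_onSet) f).symm

end LabeledClass

/-- The weight of a structure with `p` proper vertices, `c` of which correspond to components,
among `n` vertices. -/
theorem pow_sub_mul_pow_eq {K : Type*} [Field K] {u : K} (hu : u ≠ 0) (v w : K) {n p c : ℕ}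
    (h : c ≤ p) : v ^ (n - p) * u ^ (p - c) * w ^ c = v ^ (n - p) * u ^ p * (w / u) ^ c := by
  rw [div_pow, ← Nat.sub_add_cancel h, pow_add, Nat.add_sub_cancel]
  field_simp

theorem MAryTree.sum_on_eq_cayleyPoly {K : Type*} [Field K] [CharZero K] (k n : ℕ) (hk : 1 ≤ k)
    {u : K} (hu : u ≠ 0) (v w : K) :
    ∑ T : MAryTree.On (k + 1) (Finset.Icc 1 n),
        v ^ (n - T.1.prop) * u ^ (T.1.prop - T.1.comp (Nat.lt_succ_of_le hk)) *
          w ^ (T.1.comp (Nat.lt_succ_of_le hk)) =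
      cayleyPoly n ((k : K) * u) (((k : K) + 1) * v) w := by
  obtain ⟨κ, rfl⟩ := Nat.exists_eq_add_of_le' hk
  -- Taking `t = w / u` exchanges one factor `u` for `w` at each component and makes the third
  -- parameter `w`.
  have h := hasEGF_compWeight κ (Nat.lt_succ_of_le hk) u v (w / u) n (Finset.Icc 1 n) (by simp)
  rw [factorial_mul_coeff_cayleySeries, Nat.card_Icc, Nat.add_sub_cancel,
    div_mul_cancel₀ w hu] at h
  have e1 : ((κ + 1 : ℕ) : K) = κ + 1 := by push_cast; ring
  have e2 : (κ : K) + 1 + 1 = κ + 2 := by ring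
  rw [e1, e2, ← h]
  let _ : Fintype {T : MAryTree (κ + 2) // LabeledClass.labels T = (Finset.Icc 1 n).val} :=
    MAryTree.instFintypeOn (m := κ + 2) (Finset.Icc 1 n)
  refine Eq.trans ?_ (LabeledClass.sum_subtype_eq_sum_onSet (α := MAryTree (κ + 2))
    (Finset.Icc 1 n) (compWeight (Nat.lt_succ_of_le hk) u v (w / u)))
  refine Fintype.sum_congr _ _ fun T => ?_
  have hcard : T.1.labels.card = n := by rw [T.2]; simp
  rw [pow_sub_mul_pow_eq hu v w (comp_le_prop _ T.1), compWeight, weight, hcard]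

theorem ColoredForest.sum_on_eq_cayleyPoly {K : Type*} [Field K] [CharZero K] (k n : ℕ) (u : K)
    {v : K} (hv : v ≠ 0) (w : K) :
    ∑ F : ColoredForest.On k (Finset.Icc 1 n),
        u ^ (n - ColoredForest.prop F.1) * v ^ (ColoredForest.prop F.1 - ColoredForest.comp F.1) *
          w ^ (ColoredForest.comp F.1) =
      cayleyPoly n ((k : K) * u) (((k : K) + 1) * v) w := by
  have h := hasEGF_weight_mul_pow_comp k u v (w / v) n (Finset.Icc 1 n) (by simp)
  -- The forest recursion produces the first two parameters in the opposite order.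
  rw [cayleySeries_comm, factorial_mul_coeff_cayleySeries, Nat.card_Icc, Nat.add_sub_cancel,
    div_mul_cancel₀ w hv] at h
  rw [← h]
  let _ : Fintype {F : List (ColoredTree k) // LabeledClass.labels F = (Finset.Icc 1 n).val} :=
    ColoredForest.instFintypeOn (k := k) (Finset.Icc 1 n)
  refine Eq.trans ?_ (LabeledClass.sum_subtype_eq_sum_onSet (α := List (ColoredTree k))
    (Finset.Icc 1 n) fun F => weight u v F * (w / v) ^ comp F)
  refine Fintype.sum_congr _ _ fun F => ?_
  have hcard : (labels F.1).card = n := by rw [F.2]; simp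
  rw [pow_sub_mul_pow_eq hv u w (comp_le_prop F.1), weight_eq, hcard]

theorem mainTheorem8 {R : Type*} [CommRing R] (k n : ℕ) (hk : 1 ≤ k) (u v w : R) :
    (∑ T : MAryTree.On (k + 1) (Finset.Icc 1 n),
        v ^ (n - T.1.prop) * u ^ (T.1.prop - T.1.comp (Nat.lt_succ_of_le hk)) *
          w ^ (T.1.comp (Nat.lt_succ_of_le hk)) =
      ∑ F : ColoredForest.On k (Finset.Icc 1 n),
        u ^ (n - ColoredForest.prop F.1) * v ^ (ColoredForest.prop F.1 - ColoredForest.comp F.1) *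
          w ^ (ColoredForest.comp F.1)) ∧
    (∑ F : ColoredForest.On k (Finset.Icc 1 n),
        u ^ (n - ColoredForest.prop F.1) * v ^ (ColoredForest.prop F.1 - ColoredForest.comp F.1) *
          w ^ (ColoredForest.comp F.1) =
      cayleyPoly n ((k : R) * u) (((k : R) + 1) * v) w) := by
  -- The identity is proved for independent variables over `ℤ`, inside the fraction field, where
  -- division by factorials, `u` and `v` is allowed; it descends by injectivity of `ι` and then
  -- specializes to `R` along `φ`.
  let A := MvPolynomial (Fin 3) ℤ
  let ι : A →+* FractionRing A := algebraMap A (FractionRing A)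
  have hι : Function.Injective ι := IsFractionRing.injective A (FractionRing A)
  let φ : A →+* R := MvPolynomial.eval₂Hom (Int.castRingHom R) ![u, v, w]
  have : CharZero A := inferInstanceAs (CharZero (MvPolynomial (Fin 3) ℤ))
  have : CharZero (FractionRing A) := charZero_of_injective_ringHom hι
  have hX : ∀ i : Fin 3, ι (MvPolynomial.X i) ≠ 0 := fun i =>
    (map_ne_zero_iff ι hι).2 (MvPolynomial.X_ne_zero i)
  have hu : φ (MvPolynomial.X 0) = u := MvPolynomial.eval₂Hom_X' _ _ _
  have hv : φ (MvPolynomial.X 1) = v := MvPolynomial.eval₂Hom_X' _ _ _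
  have hw : φ (MvPolynomial.X 2) = w := MvPolynomial.eval₂Hom_X' _ _ _
  have hT := MAryTree.sum_on_eq_cayleyPoly k n hk (hX 0) (ι (MvPolynomial.X 1))
    (ι (MvPolynomial.X 2))
  have hF := ColoredForest.sum_on_eq_cayleyPoly k n (ι (MvPolynomial.X 0)) (hX 1)
    (ι (MvPolynomial.X 2))
  rw [← map_natCast ι k, ← map_one ι, ← map_add, ← map_mul, ← map_mul, ← map_cayleyPoly] at hT hF
  simp only [← map_pow, ← map_mul, ← map_sum] at hT hF
  have hT := congrArg φ (hι hT)
  have hF := congrArg φ (hι hF)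
  rw [map_cayleyPoly] at hT hF
  simp only [map_pow, map_mul, map_sum, map_add, map_one, map_natCast, hu, hv, hw] at hT hF
  exact ⟨hT.trans hF.symm, hF⟩
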